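/- All graphs are simple, and "graph" below means finite graph unless stated otherwise. A 2-switch $\binom{a\ b}{c\ d}$ is active in a graph $G$ if $ab,cd$ are disjoint edges of $G$ and $ac,bd$ are not edges of $G$; a vertex $v$ of $G$ is active if some 2-switch active in $G$ has $v\in\{a,b,c,d\}$ (equivalently, $v$ lies in an induced $P_4$, $C_4$ or $2K_2$); $G$ is active if all its vertices are active. A split graph $(S,K,I)$ is a graph $S$ whose vertex set is the disjoint union of a clique $K$ and an independent set $I$. If $G$ is a graph disjoint from $S$, the Tyshkevich composition $S\circ G$ has vertex set $V(S)\cup V(G)$ and edge set $E(S)\cup E(G)\cup\{xy: x\in K,\ y\in V(G)\}$; it is associative, and an iterated composition is also called a product. A graph is reducible if it equals $S\circ H$ for some non-null split graph $S$ and non-null graph $H$ disjoint from $S$, and irreducible otherwise. A graph is prime if it is active and irreducible. The factor multigraph $\Phi(S)$ of $(S,K,I)$ is the loopless multigraph with vertex set $I$ in which two distinct vertices $u,v\in I$ are joined by exactly one edge for each induced $P_4$ of $S$ that contains both $u$ and $v$. A (multi)graph is connected if any two of its vertices are joined by a path; those with $0$ or $1$ vertices count as connected. Theorem. Let $(S,K,I)$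 be an active split graph. (0) If $\Phi(S)$ is connected, then $S$ is irreducible. (1) $S$ is prime if and only if $\Phi(S)$ is connected. (2) If $S=S_1\circ S_2\circ\cdots\circ S_n$, where the $S_k$ are pairwise disjoint prime split graphs, then $\Phi(S)$ is the disjoint union $\dot{\bigcup}_{k=1}^{n}\Phi(S_k)$ (equality of multigraphs: same vertex set and same edge multiplicities). (3) If $G$ is an active graph (not necessarily split or finite) and $G=G_n\circ\cdots\circ G_2\circ G_1$ is a decomposition of $G$ as a Tyshkevich composition of pairwise disjoint irreducible factors, where $G_2,\dots,G_n$ are split graphs with fixed bipartitions, then each factor $G_r$ is prime. -/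

import Mathlib

namespace TyshkevichGraph

/-- A labelled simple graph whose vertex set is a subset of `α`, that is, a pair of a vertex set
`G.verts ⊆ α` and an irreflexive symmetric adjacency relation `G.Adj` on it. Equality is equality
of vertex sets and of edge sets. -/
abbrev LGraph (α : Type*) := (⊤ : SimpleGraph α).Subgraph

/-- The 2-switch replacing the edges `ab`, `cd` by `ac`, `bd` is active in `G`: `ab` and `cd` are
disjoint edges of `G`, while `ac` and `bd` are not edges of `G`. -/
def IsActiveSwitch {α : Type*} (G : LGraph α) (a b c d : α) : Prop :=
  G.Adj a b ∧ G.Adj c d ∧ a ≠ c ∧ a ≠ d ∧ b ≠ c ∧ b ≠ d ∧ ¬ G.Adj a c ∧ ¬ G.Adj b d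

/-- A vertex is active in `G` if some 2-switch that is active in `G` involves it. -/
def IsActiveVertex {α : Type*} (G : LGraph α) (v : α) : Prop :=
  ∃ a b c d : α, IsActiveSwitch G a b c d ∧ (v = a ∨ v = b ∨ v = c ∨ v = d)

/-- A graph is active if all its vertices are active. -/
def IsActive {α : Type*} (G : LGraph α) : Prop :=
  ∀ v ∈ G.verts, IsActiveVertex G v

/-- A bipartitioned split graph `(S, K, I)`: the vertex set of `S` is the disjoint union of a
clique `K` and an independent set `I`. -/
structure SplitGraph (α : Type*) where
  graph : LGraph α
  K : Set α
  I : Set α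
  disjoint : Disjoint K I
  union_eq : K ∪ I = graph.verts
  clique : ∀ ⦃x⦄, x ∈ K → ∀ ⦃y⦄, y ∈ K → x ≠ y → graph.Adj x y
  indep : ∀ ⦃x⦄, x ∈ I → ∀ ⦃y⦄, y ∈ I → ¬ graph.Adj x y

/-- The Tyshkevich composition `S ∘ G`: the union of `S` and `G`, with all edges between the clique
of `S` and the vertices of `G` added. It is only used when `S` and `G` have disjoint vertex sets
(in which case `x ≠ y` is automatic below). -/
def comp {α : Type*} (S : SplitGraph α) (G : LGraph α) : LGraph α where
  verts := S.graph.verts ∪ G.verts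
  Adj x y := S.graph.Adj x y ∨ G.Adj x y ∨
    (x ≠ y ∧ ((x ∈ S.K ∧ y ∈ G.verts) ∨ (y ∈ S.K ∧ x ∈ G.verts)))
  adj_sub := by
    rintro x y (h | h | h)
    · exact h.adj_sub
    · exact h.adj_sub
    · exact h.1
  edge_vert := by
    rintro x y (h | h | ⟨-, ⟨h, -⟩ | ⟨-, h⟩⟩)
    · exact Or.inl h.fst_mem
    · exact Or.inr h.fst_mem
    · exact Or.inl (S.union_eq ▸ Or.inl h)
    · exact Or.inr h
  symm := ⟨by
    rintro x y (h | h | ⟨hne, h⟩)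
    · exact Or.inl h.symm
    · exact Or.inr (Or.inl h.symm)
    · exact Or.inr (Or.inr ⟨hne.symm, h.symm⟩)⟩

/-- The iterated composition `S₁ ∘ (S₂ ∘ (⋯ ∘ (Sₘ ∘ G)))` for `L = [S₁, …, Sₘ]`. -/
def compList {α : Type*} (L : List (SplitGraph α)) (G : LGraph α) : LGraph α :=
  L.foldr comp G

/-- The product `S₁ ∘ S₂ ∘ ⋯ ∘ Sₘ` of split graphs (`⊥` is the null graph, and `Sₘ ∘ ⊥ = Sₘ`). -/
def prod {α : Type*} (L : List (SplitGraph α)) : LGraph α :=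
  compList L ⊥

/-- `G` is reducible if `G = S ∘ H` for some non-null split graph `S` (with some bipartition) and
some non-null graph `H` disjoint from `S`. -/
def IsReducible {α : Type*} (G : LGraph α) : Prop :=
  ∃ (S : SplitGraph α) (H : LGraph α), S.graph.verts.Nonempty ∧ H.verts.Nonempty ∧
    Disjoint S.graph.verts H.verts ∧ G = comp S H

def IsIrreducible {α : Type*} (G : LGraph α) : Prop :=
  ¬ IsReducible G

/-- A graph is prime if it is active and irreducible. -/
def IsPrime {α : Type*} (G : LGraph α) : Prop :=
  IsActive G ∧ IsIrreducible G

/-- The vertex set `H` induces in `G` a path `P₄` on four vertices. -/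
def InducesP4 {α : Type*} (G : LGraph α) (H : Set α) : Prop :=
  H ⊆ G.verts ∧ Nonempty ((G.induce H).coe ≃g SimpleGraph.pathGraph 4)

/-- A multigraph: a vertex set together with a multiset of edges, given by the multiplicity
`mult s(u, v)` of each unordered pair of vertices. -/
@[ext]
structure Multigraph (α : Type*) where
  verts : Set α
  mult : Sym2 α → ℕ
  mem_verts : ∀ e, mult e ≠ 0 → ∀ x ∈ e, x ∈ verts

/-- The simple graph underlying a multigraph (multiplicities are ignored). -/
def Multigraph.toSimple {α : Type*} (M : Multigraph α) : SimpleGraph M.verts :=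
  SimpleGraph.fromRel fun u v => M.mult s((u : α), (v : α)) ≠ 0

/-- Any two vertices are joined by a path. Multigraphs with at most one vertex (including the null
one) count as connected. -/
def Multigraph.IsConnected {α : Type*} (M : Multigraph α) : Prop :=
  M.toSimple.Preconnected

/-- The union of a list of multigraphs: the union of the vertex sets, and the multiset sum of the
edge multisets. It is the disjoint union when the vertex sets are pairwise disjoint. -/
def Multigraph.listUnion {α : Type*} (L : List (Multigraph α)) : Multigraph α where
  verts := {x | ∃ M ∈ L, x ∈ M.verts}
  mult e := (L.map fun M => M.mult e).sum
  mem_verts e he x hx := by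
    by_contra h
    apply he
    apply List.sum_eq_zero
    intro n hn
    obtain ⟨M, hM, rfl⟩ := List.mem_map.1 hn
    by_contra hne
    exact h ⟨M, hM, M.mem_verts e hne x hx⟩

/-- The factor multigraph `Φ(S)` of `(S, K, I)`: its vertex set is `I`, and two distinct vertices
`u, v ∈ I` are joined by one edge for each induced `P₄` of `S` that contains both. -/
noncomputable def SplitGraph.factor {α : Type*} (S : SplitGraph α) : Multigraph α where
  verts := S.I
  mult e := Set.ncard {H : Set α |
    ¬ e.IsDiag ∧ (∀ x ∈ e, x ∈ S.I ∧ x ∈ H) ∧ InducesP4 S.graph H}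
  mem_verts e he x hx := by
    obtain ⟨H, hH⟩ := Set.nonempty_of_ncard_ne_zero he
    exact (hH.2.1 x hx).1

end TyshkevichGraph

/-! In a split graph every active switch spans an induced `P₄` with its ends in `I` and its inner
vertices in `K`. In a composition `S ∘ G` no active switch uses vertices of both sides
(`switch_comp_mem_verts`). Hence activity passes to the factors, which gives (3), and the induced
`P₄`s of a product are those of its factors (`inducesP4_prod_iff`), which gives (2) once the
bipartitions of the factors are matched with that of `S`.

For (0), both sides of a decomposition of an active `S` would contain vertices of `I`, while no edge
of `Φ(S)` crosses between them.

For the converse in (1), nonadjacent vertices of `Φ(S)` have comparable neighbourhoods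
(`factor_adj_iff`). If `Φ(S)` is disconnected, the vertices whose neighbourhood lies inside that of
some member of a suitable component form a set `J` that splits off together with its neighbours
(`isReducible_of_neighbors_le`). -/

namespace TyshkevichGraph

variable {α : Type*}

/-! ### Induced `P₄`s as labelled paths -/

/-- The vertices `a, b, c, d` form, in this order, an induced path of `G`. -/
def IsPath4 (G : LGraph α) (a b c d : α) : Prop :=
  G.Adj a b ∧ G.Adj b c ∧ G.Adj c d ∧ ¬ G.Adj a c ∧ ¬ G.Adj a d ∧ ¬ G.Adj b d

theorem IsPath4.switch {G : LGraph α} {a b c d : α} (h : IsPath4 G a b c d) :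
    IsActiveSwitch G a b c d := by
  obtain ⟨hab, hbc, hcd, hac, had, hbd⟩ := h
  refine ⟨hab, hcd, ?_, ?_, hbc.ne, ?_, hac, hbd⟩
  · rintro rfl; exact had hcd
  · rintro rfl; exact hac hcd.symm
  · rintro rfl; exact had hab

theorem inducesP4_iff {G : LGraph α} {H : Set α} :
    InducesP4 G H ↔ ∃ a b c d, IsPath4 G a b c d ∧ H = {a, b, c, d} := by
  constructor
  · rintro ⟨hH, ⟨f⟩⟩
    have key : ∀ i j : Fin 4, G.Adj (f.symm i).1 (f.symm j).1 ↔
        (SimpleGraph.pathGraph 4).Adj i j := by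
      intro i j
      have h := f.symm.map_rel_iff (a := i) (b := j)
      rw [← h]
      constructor
      · intro hG
        exact ⟨(f.symm i).2, (f.symm j).2, hG⟩
      · intro hG
        exact hG.2.2
    refine ⟨(f.symm 0).1, (f.symm 1).1, (f.symm 2).1, (f.symm 3).1, ?_, ?_⟩
    · simp only [IsPath4, key, SimpleGraph.pathGraph_adj]
      decide
    · ext x
      simp only [Set.mem_insert_iff, Set.mem_singleton_iff]
      constructor
      · intro hx
        have hx' : (f.symm (f ⟨x, hx⟩)).1 = x := by simp
        generalize f ⟨x, hx⟩ = i at hx'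
        subst hx'
        fin_cases i <;> simp
      · rintro (rfl | rfl | rfl | rfl)
        · exact (f.symm 0).2
        · exact (f.symm 1).2
        · exact (f.symm 2).2
        · exact (f.symm 3).2
  · rintro ⟨a, b, c, d, h, rfl⟩
    have hs := h.switch
    obtain ⟨hab, hbc, hcd, hac, had, hbd⟩ := h
    obtain ⟨-, -, nac, nad, -, nbd, -, -⟩ := hs
    refine ⟨?_, ?_⟩
    · rintro x (rfl | rfl | rfl | rfl)
      exacts [hab.fst_mem, hbc.fst_mem, hcd.fst_mem, hcd.snd_mem]
    · have hm : ∀ i, (![a, b, c, d] : Fin 4 → α) i ∈ ({a, b, c, d} : Set α) := by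
        intro i
        fin_cases i <;> simp
      let g : Fin 4 → (G.induce {a, b, c, d}).verts := fun i => ⟨![a, b, c, d] i, hm i⟩
      have hg : Function.Bijective g := by
        constructor
        · intro i j hij
          have hij' : (![a, b, c, d] : Fin 4 → α) i = ![a, b, c, d] j := congrArg Subtype.val hij
          have nab := hab.ne
          have nbc := hbc.ne
          have ncd := hcd.ne
          fin_cases i <;> fin_cases j <;> simp_all
        · rintro ⟨x, rfl | rfl | rfl | rfl⟩
          exacts [⟨0, rfl⟩, ⟨1, rfl⟩, ⟨2, rfl⟩, ⟨3, rfl⟩]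
      refine ⟨SimpleGraph.Iso.symm ⟨Equiv.ofBijective g hg, ?_⟩⟩
      intro i j
      have h1 : (G.induce {a, b, c, d}).coe.Adj (g i) (g j) ↔
          G.Adj (![a, b, c, d] i) (![a, b, c, d] j) :=
        ⟨fun h => h.2.2, fun h => ⟨hm i, hm j, h⟩⟩
      refine h1.trans ?_
      rw [SimpleGraph.pathGraph_adj]
      have hirr : ∀ x, ¬ G.Adj x x := fun x hx => hx.ne rfl
      fin_cases i <;> fin_cases j <;>
        simp [hab, hbc, hcd, hac, had, hbd, hab.symm, hbc.symm, hcd.symm, hirr,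
          G.adj_comm c a, G.adj_comm d a, G.adj_comm d b]

theorem InducesP4.finite {G : LGraph α} (hG : G.verts.Finite) :
    {H : Set α | InducesP4 G H}.Finite :=
  hG.finite_subsets.subset fun _ hH => hH.1

theorem InducesP4.nonempty {G : LGraph α} {H : Set α} (h : InducesP4 G H) : H.Nonempty := by
  obtain ⟨a, b, c, d, -, rfl⟩ := inducesP4_iff.1 h
  exact ⟨a, Set.mem_insert _ _⟩

theorem IsActiveSwitch.symm {G : LGraph α} {a b c d : α} (h : IsActiveSwitch G a b c d) :
    IsActiveSwitch G b a d c := by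
  obtain ⟨hab, hcd, nac, nad, nbc, nbd, hac, hbd⟩ := h
  exact ⟨hab.symm, hcd.symm, nbd, nbc, nad, nac, hbd, hac⟩

/-! ### Active switches in split graphs -/

namespace SplitGraph

theorem mem_K_or_mem_I (S : SplitGraph α) {x : α} (hx : x ∈ S.graph.verts) :
    x ∈ S.K ∨ x ∈ S.I := by
  rwa [← S.union_eq] at hx

theorem K_subset_verts (S : SplitGraph α) : S.K ⊆ S.graph.verts :=
  S.union_eq ▸ Set.subset_union_left

theorem I_subset_verts (S : SplitGraph α) : S.I ⊆ S.graph.verts :=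
  S.union_eq ▸ Set.subset_union_right

theorem notMem_I_of_mem_K (S : SplitGraph α) {x : α} (hx : x ∈ S.K) : x ∉ S.I :=
  Set.disjoint_left.1 S.disjoint hx

theorem mem_K_of_adj (S : SplitGraph α) {x y : α} (h : S.graph.Adj x y) (hx : x ∈ S.I) :
    y ∈ S.K :=
  (S.mem_K_or_mem_I h.snd_mem).resolve_right fun hy => S.indep hx hy h

/-- A non-edge cannot have both ends in `K`, nor an edge both ends in `I`; so the side of `a`
determines the other three sides, and the two vertices in `K` supply the middle edge of the path. -/
theorem path_or_path_of_switch (S : SplitGraph α) {a b c d : α}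
    (h : IsActiveSwitch S.graph a b c d) :
    (IsPath4 S.graph a b c d ∧ a ∈ S.I ∧ b ∈ S.K ∧ c ∈ S.K ∧ d ∈ S.I) ∨
      (IsPath4 S.graph b a d c ∧ b ∈ S.I ∧ a ∈ S.K ∧ d ∈ S.K ∧ c ∈ S.I) := by
  have key : ∀ {a b c d : α}, IsActiveSwitch S.graph a b c d → a ∈ S.I →
      IsPath4 S.graph a b c d ∧ a ∈ S.I ∧ b ∈ S.K ∧ c ∈ S.K ∧ d ∈ S.I := by
    rintro a b c d ⟨hab, hcd, nac, nad, nbc, nbd, hac, hbd⟩ ha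
    have hb := S.mem_K_of_adj hab ha
    have hd : d ∈ S.I :=
      (S.mem_K_or_mem_I hcd.snd_mem).resolve_left fun hd => hbd (S.clique hb hd nbd)
    have hc := S.mem_K_of_adj hcd.symm hd
    exact ⟨⟨hab, S.clique hb hc nbc, hcd, hac, S.indep ha hd, hbd⟩, ha, hb, hc, hd⟩
  rcases S.mem_K_or_mem_I h.1.fst_mem with ha | ha
  · right
    obtain ⟨hab, hcd, nac, -, -, nbd, hac, hbd⟩ := id h
    have hc : c ∈ S.I :=
      (S.mem_K_or_mem_I hcd.fst_mem).resolve_left fun hc => hac (S.clique ha hc nac)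
    have hd := S.mem_K_of_adj hcd hc
    have hb : b ∈ S.I :=
      (S.mem_K_or_mem_I hab.snd_mem).resolve_left fun hb => hbd (S.clique hb hd nbd)
    exact key h.symm hb
  · exact Or.inl (key h ha)

theorem mem_of_path (S : SplitGraph α) {a b c d : α} (h : IsPath4 S.graph a b c d) :
    a ∈ S.I ∧ b ∈ S.K ∧ c ∈ S.K ∧ d ∈ S.I := by
  rcases S.path_or_path_of_switch h.switch with ⟨-, h'⟩ | ⟨-, hb, -, -, hc⟩
  · exact h'
  · exact absurd h.2.1 (S.indep hb hc)

theorem exists_path_of_isActiveVertex (S : SplitGraph α) {v : α}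
    (h : IsActiveVertex S.graph v) :
    ∃ a b c d, IsPath4 S.graph a b c d ∧ (v = a ∨ v = b ∨ v = c ∨ v = d) := by
  obtain ⟨a, b, c, d, hs, hv⟩ := h
  rcases S.path_or_path_of_switch hs with ⟨h', -⟩ | ⟨h', -⟩
  · exact ⟨a, b, c, d, h', hv⟩
  · exact ⟨b, a, d, c, h', by tauto⟩

theorem exists_path_of_mem_I (S : SplitGraph α) {v : α} (hv : v ∈ S.I)
    (h : IsActiveVertex S.graph v) : ∃ b c d, IsPath4 S.graph v b c d := by
  obtain ⟨a, b, c, d, hp, hv'⟩ := S.exists_path_of_isActiveVertex h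
  obtain ⟨ha, hb, hc, hd⟩ := S.mem_of_path hp
  rcases hv' with rfl | rfl | rfl | rfl
  · exact ⟨b, c, d, hp⟩
  · exact absurd hv (S.notMem_I_of_mem_K hb)
  · exact absurd hv (S.notMem_I_of_mem_K hc)
  · obtain ⟨hab, hbc, hcd, hac, had, hbd⟩ := hp
    exact ⟨c, b, a, hcd.symm, hbc.symm, hab.symm, fun h => hbd h.symm, fun h => had h.symm,
      fun h => hac h.symm⟩

/-- Used for the two sides of a decomposition of `S`: a switch active in one side is active in `S`,
so it has vertices in `I`. -/
theorem exists_mem_I (S : SplitGraph α) {G : LGraph α} (hG : G.verts.Nonempty)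
    (hact : IsActive G) (hadj : ∀ x ∈ G.verts, ∀ y ∈ G.verts, G.Adj x y ↔ S.graph.Adj x y) :
    ∃ x ∈ G.verts, x ∈ S.I := by
  obtain ⟨v, hv⟩ := hG
  obtain ⟨a, b, c, d, ⟨hab, hcd, nac, nad, nbc, nbd, hac, hbd⟩, -⟩ := hact v hv
  have hs : IsActiveSwitch S.graph a b c d :=
    ⟨(hadj _ hab.fst_mem _ hab.snd_mem).1 hab, (hadj _ hcd.fst_mem _ hcd.snd_mem).1 hcd,
      nac, nad, nbc, nbd, fun h => hac ((hadj _ hab.fst_mem _ hcd.fst_mem).2 h),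
      fun h => hbd ((hadj _ hab.snd_mem _ hcd.snd_mem).2 h)⟩
  rcases S.path_or_path_of_switch hs with ⟨-, ha, -⟩ | ⟨-, hb, -⟩
  · exact ⟨a, hab.fst_mem, ha⟩
  · exact ⟨b, hab.snd_mem, hb⟩

end SplitGraph

/-! ### Switches and paths in a composition -/

section Composition

variable {S : SplitGraph α} {G : LGraph α}

theorem comp_adj_left (hd : Disjoint S.graph.verts G.verts) {x y : α}
    (hx : x ∈ S.graph.verts) (hy : y ∈ S.graph.verts) :
    (comp S G).Adj x y ↔ S.graph.Adj x y := by
  have hx' := Set.disjoint_left.1 hd hx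
  have hy' := Set.disjoint_left.1 hd hy
  constructor
  · rintro (h | h | ⟨-, ⟨-, h⟩ | ⟨-, h⟩⟩)
    exacts [h, absurd h.fst_mem hx', absurd h hy', absurd h hx']
  · exact Or.inl

theorem comp_adj_right (hd : Disjoint S.graph.verts G.verts) {x y : α}
    (hx : x ∈ G.verts) (hy : y ∈ G.verts) :
    (comp S G).Adj x y ↔ G.Adj x y := by
  have hx' := Set.disjoint_right.1 hd hx
  have hy' := Set.disjoint_right.1 hd hy
  constructor
  · rintro (h | h | ⟨-, ⟨h, -⟩ | ⟨h, -⟩⟩)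
    exacts [absurd h.fst_mem hx', h, absurd (S.K_subset_verts h) hx',
      absurd (S.K_subset_verts h) hy']
  · exact fun h => Or.inr (Or.inl h)

theorem comp_adj_left_right (hd : Disjoint S.graph.verts G.verts) {x y : α}
    (hx : x ∈ S.graph.verts) (hy : y ∈ G.verts) :
    (comp S G).Adj x y ↔ x ∈ S.K := by
  have hx' := Set.disjoint_left.1 hd hx
  have hy' := Set.disjoint_right.1 hd hy
  constructor
  · rintro (h | h | ⟨-, ⟨h, -⟩ | ⟨-, h⟩⟩)
    exacts [absurd h.snd_mem hy', absurd h.fst_mem hx', h, absurd h hx']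
  · intro h
    refine Or.inr (Or.inr ⟨?_, Or.inl ⟨h, hy⟩⟩)
    rintro rfl
    exact hx' hy

/-- The non-edge `ac` would put `c` in the independent part of `S`, hence `d` in the clique. The
non-edge `bd` then keeps `b` out of `G`, and the edge `ab` puts `b` in the clique too, contradicting
the non-edge `bd`. -/
theorem not_switch_comp_of_mem (hd : Disjoint S.graph.verts G.verts) {a b c d : α}
    (h : IsActiveSwitch (comp S G) a b c d) (ha : a ∈ G.verts) : c ∉ S.graph.verts := by
  obtain ⟨hab, hcd, nac, nad, nbc, nbd, hac, hbd⟩ := h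
  intro hc
  have hcK : c ∉ S.K := fun hK => hac ((comp_adj_left_right hd hc ha).2 hK).symm
  have hcI := (S.mem_K_or_mem_I hc).resolve_left hcK
  have hdS : d ∈ S.graph.verts :=
    hcd.snd_mem.resolve_right fun h => hcK ((comp_adj_left_right hd hc h).1 hcd)
  have hdK := S.mem_K_of_adj ((comp_adj_left hd hc hdS).1 hcd) hcI
  have hbS : b ∈ S.graph.verts :=
    hab.snd_mem.resolve_right fun h => hbd ((comp_adj_left_right hd hdS h).2 hdK).symm
  have hbK := (comp_adj_left_right hd hbS ha).1 hab.symm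
  exact hbd ((comp_adj_left hd hbS hdS).2 (S.clique hbK hdK nbd))

theorem IsActiveSwitch.reverse {a b c d : α} (h : IsActiveSwitch G a b c d) :
    IsActiveSwitch G c d a b := by
  obtain ⟨hab, hcd, nac, nad, nbc, nbd, hac, hbd⟩ := h
  exact ⟨hcd, hab, nac.symm, nbc.symm, nad.symm, nbd.symm, fun h => hac h.symm,
    fun h => hbd h.symm⟩

theorem switch_comp_mem_verts (hd : Disjoint S.graph.verts G.verts) {a b c d : α}
    (h : IsActiveSwitch (comp S G) a b c d) :
    (a ∈ S.graph.verts ∧ b ∈ S.graph.verts ∧ c ∈ S.graph.verts ∧ d ∈ S.graph.verts) ∨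
      (a ∈ G.verts ∧ b ∈ G.verts ∧ c ∈ G.verts ∧ d ∈ G.verts) := by
  have ha : a ∈ S.graph.verts ∨ a ∈ G.verts := h.1.fst_mem
  have hb : b ∈ S.graph.verts ∨ b ∈ G.verts := h.1.snd_mem
  have hc : c ∈ S.graph.verts ∨ c ∈ G.verts := h.2.1.fst_mem
  have hd' : d ∈ S.graph.verts ∨ d ∈ G.verts := h.2.1.snd_mem
  have h1 := not_switch_comp_of_mem hd h
  have h2 := not_switch_comp_of_mem hd h.reverse
  have h3 := not_switch_comp_of_mem hd h.symm
  have h4 := not_switch_comp_of_mem hd h.symm.reverse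
  -- By now `a`, `c` lie on one side, and so do `b`, `d`. It remains to exclude these pairs being on
  -- opposite sides: two vertices of `S` with neighbours in `G` are both in the clique, hence
  -- adjacent.
  have cross : ∀ {a b c d : α}, IsActiveSwitch (comp S G) a b c d → a ∈ S.graph.verts →
      c ∈ S.graph.verts → b ∈ G.verts → d ∈ G.verts → False := by
    rintro a b c d ⟨hab, hcd, nac, -, -, -, hac, -⟩ ha hc hb hd'
    exact hac ((comp_adj_left hd ha hc).2 (S.clique ((comp_adj_left_right hd ha hb).1 hab)
      ((comp_adj_left_right hd hc hd').1 hcd) nac))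
  have h5 := cross h
  have h6 := cross h.symm
  tauto

theorem switch_comp_iff (hd : Disjoint S.graph.verts G.verts) {a b c d : α} :
    IsActiveSwitch (comp S G) a b c d ↔
      IsActiveSwitch S.graph a b c d ∨ IsActiveSwitch G a b c d := by
  constructor
  · intro h
    rcases switch_comp_mem_verts hd h with ⟨ha, hb, hc, hd'⟩ | ⟨ha, hb, hc, hd'⟩
    · left
      simpa only [IsActiveSwitch, comp_adj_left hd, ha, hb, hc, hd'] using h
    · right
      simpa only [IsActiveSwitch, comp_adj_right hd, ha, hb, hc, hd'] using h
  · rintro (h | h)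
    · have ha := h.1.fst_mem
      have hb := h.1.snd_mem
      have hc := h.2.1.fst_mem
      have hd' := h.2.1.snd_mem
      simpa only [IsActiveSwitch, comp_adj_left hd, ha, hb, hc, hd'] using h
    · have ha := h.1.fst_mem
      have hb := h.1.snd_mem
      have hc := h.2.1.fst_mem
      have hd' := h.2.1.snd_mem
      simpa only [IsActiveSwitch, comp_adj_right hd, ha, hb, hc, hd'] using h

theorem path_comp_iff (hd : Disjoint S.graph.verts G.verts) {a b c d : α} :
    IsPath4 (comp S G) a b c d ↔ IsPath4 S.graph a b c d ∨ IsPath4 G a b c d := by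
  constructor
  · intro h
    rcases switch_comp_mem_verts hd h.switch with ⟨ha, hb, hc, hd'⟩ | ⟨ha, hb, hc, hd'⟩
    · left
      simpa only [IsPath4, comp_adj_left hd, ha, hb, hc, hd'] using h
    · right
      simpa only [IsPath4, comp_adj_right hd, ha, hb, hc, hd'] using h
  · rintro (h | h)
    · have ha := h.1.fst_mem
      have hb := h.1.snd_mem
      have hc := h.2.2.1.fst_mem
      have hd' := h.2.2.1.snd_mem
      simpa only [IsPath4, comp_adj_left hd, ha, hb, hc, hd'] using h
    · have ha := h.1.fst_mem
      have hb := h.1.snd_mem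
      have hc := h.2.2.1.fst_mem
      have hd' := h.2.2.1.snd_mem
      simpa only [IsPath4, comp_adj_right hd, ha, hb, hc, hd'] using h

theorem isActive_of_isActive_comp (hd : Disjoint S.graph.verts G.verts)
    (h : IsActive (comp S G)) : IsActive S.graph ∧ IsActive G := by
  constructor
  · intro v hv
    obtain ⟨a, b, c, d, hs, hv'⟩ := h v (Or.inl hv)
    refine ⟨a, b, c, d, ((switch_comp_iff hd).1 hs).resolve_right fun hs' => ?_, hv'⟩
    apply Set.disjoint_left.1 hd hv
    rcases hv' with rfl | rfl | rfl | rfl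
    exacts [hs'.1.fst_mem, hs'.1.snd_mem, hs'.2.1.fst_mem, hs'.2.1.snd_mem]
  · intro v hv
    obtain ⟨a, b, c, d, hs, hv'⟩ := h v (Or.inr hv)
    refine ⟨a, b, c, d, ((switch_comp_iff hd).1 hs).resolve_left fun hs' => ?_, hv'⟩
    apply Set.disjoint_right.1 hd hv
    rcases hv' with rfl | rfl | rfl | rfl
    exacts [hs'.1.fst_mem, hs'.1.snd_mem, hs'.2.1.fst_mem, hs'.2.1.snd_mem]

end Composition

/-! ### Iterated compositions -/

section Lists

theorem mem_verts_compList {L : List (SplitGraph α)} {G : LGraph α} {x : α} :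
    x ∈ (compList L G).verts ↔ (∃ T ∈ L, x ∈ T.graph.verts) ∨ x ∈ G.verts := by
  induction L with
  | nil => simp [compList]
  | cons T L ih =>
    have : x ∈ (compList (T :: L) G).verts ↔
      x ∈ T.graph.verts ∨ x ∈ (compList L G).verts := Iff.rfl
    rw [this, ih]
    simp [or_assoc]

theorem disjoint_verts_compList {T : SplitGraph α} {L : List (SplitGraph α)} {G : LGraph α}
    (hL : ∀ T' ∈ L, Disjoint T.graph.verts T'.graph.verts)
    (hG : Disjoint T.graph.verts G.verts) :
    Disjoint T.graph.verts (compList L G).verts := by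
  rw [Set.disjoint_left]
  intro x hx hx'
  rcases mem_verts_compList.1 hx' with ⟨T', hT', h⟩ | h
  · exact Set.disjoint_left.1 (hL T' hT') hx h
  · exact Set.disjoint_left.1 hG hx h

theorem isActive_of_isActive_compList {L : List (SplitGraph α)} {G : LGraph α}
    (hL : L.Pairwise fun T T' => Disjoint T.graph.verts T'.graph.verts)
    (hG : ∀ T ∈ L, Disjoint T.graph.verts G.verts) (h : IsActive (compList L G)) :
    (∀ T ∈ L, IsActive T.graph) ∧ IsActive G := by
  induction L with
  | nil => exact ⟨by simp, h⟩
  | cons T L ih =>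
    obtain ⟨hT, hL⟩ := List.pairwise_cons.1 hL
    obtain ⟨h1, h2⟩ := isActive_of_isActive_comp
      (disjoint_verts_compList hT (hG T List.mem_cons_self)) h
    obtain ⟨h3, h4⟩ := ih hL (fun T' hT' => hG T' (List.mem_cons_of_mem _ hT')) h2
    refine ⟨?_, h4⟩
    intro T' hT'
    rcases List.mem_cons.1 hT' with rfl | hT'
    exacts [h1, h3 T' hT']

theorem path_prod_iff {L : List (SplitGraph α)}
    (hL : L.Pairwise fun T T' => Disjoint T.graph.verts T'.graph.verts) {a b c d : α} :
    IsPath4 (prod L) a b c d ↔ ∃ T ∈ L, IsPath4 T.graph a b c d := by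
  induction L with
  | nil => simp [prod, compList, IsPath4]
  | cons T L ih =>
    obtain ⟨hT, hL⟩ := List.pairwise_cons.1 hL
    have : IsPath4 (prod (T :: L)) a b c d ↔
        IsPath4 T.graph a b c d ∨ IsPath4 (prod L) a b c d :=
      path_comp_iff (disjoint_verts_compList hT (by simp))
    rw [this, ih hL]
    simp

theorem inducesP4_prod_iff {L : List (SplitGraph α)}
    (hL : L.Pairwise fun T T' => Disjoint T.graph.verts T'.graph.verts) {H : Set α} :
    InducesP4 (prod L) H ↔ ∃ T ∈ L, InducesP4 T.graph H := by
  simp only [inducesP4_iff, path_prod_iff hL]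
  constructor
  · rintro ⟨a, b, c, d, ⟨T, hT, h⟩, hH⟩
    exact ⟨T, hT, a, b, c, d, h, hH⟩
  · rintro ⟨T, hT, a, b, c, d, h, hH⟩
    exact ⟨a, b, c, d, ⟨T, hT, h⟩, hH⟩

end Lists

/-! ### The factor multigraph of a product -/

namespace SplitGraph

/-- An active split factor of a split product inherits its bipartition. -/
theorem I_eq_inter_of_prod {S : SplitGraph α} {L : List (SplitGraph α)}
    (hL : L.Pairwise fun T T' => Disjoint T.graph.verts T'.graph.verts)
    (hS : S.graph = prod L) {T : SplitGraph α} (hT : T ∈ L) (hact : IsActive T.graph) :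
    T.I = S.I ∩ T.graph.verts := by
  ext x
  constructor
  · intro hx
    obtain ⟨b, c, d, hp⟩ := T.exists_path_of_mem_I hx (hact x (T.I_subset_verts hx))
    have hp' : IsPath4 S.graph x b c d := hS ▸ (path_prod_iff hL).2 ⟨T, hT, hp⟩
    exact ⟨(S.mem_of_path hp').1, T.I_subset_verts hx⟩
  · rintro ⟨hxS, hx⟩
    -- A path through `x` is induced in both `T` and `S`, and the position of `x` on it, end or
    -- inner, decides its side in either bipartition.
    obtain ⟨a, b, c, d, hp, hx'⟩ := T.exists_path_of_isActiveVertex (hact x hx)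
    have hp' : IsPath4 S.graph a b c d := hS ▸ (path_prod_iff hL).2 ⟨T, hT, hp⟩
    obtain ⟨ha, hb, hc, hd⟩ := S.mem_of_path hp'
    obtain ⟨ha', -, -, hd'⟩ := T.mem_of_path hp
    rcases hx' with rfl | rfl | rfl | rfl
    · exact ha'
    · exact absurd hxS (S.notMem_I_of_mem_K hb)
    · exact absurd hxS (S.notMem_I_of_mem_K hc)
    · exact hd'

/-- The fixed set `J`, later `S.I`, lets the induction drop factors while the endpoint condition
stays the same. The counts add up because induced `P₄`s of disjoint factors are different sets. -/
theorem sum_mult_factor {J : Set α} {L : List (SplitGraph α)}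
    (hL : L.Pairwise fun T T' => Disjoint T.graph.verts T'.graph.verts)
    (hfin : ∀ T ∈ L, T.graph.verts.Finite) (hI : ∀ T ∈ L, T.I = J ∩ T.graph.verts)
    (e : Sym2 α) :
    (L.map fun T => T.factor.mult e).sum =
      Set.ncard {H : Set α | ¬ e.IsDiag ∧ (∀ x ∈ e, x ∈ J ∧ x ∈ H) ∧
        ∃ T ∈ L, InducesP4 T.graph H} := by
  induction L with
  | nil => simp
  | cons T L ih =>
    obtain ⟨hT, hL⟩ := List.pairwise_cons.1 hL
    rw [List.map_cons, List.sum_cons, ih hL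
      (fun T' hT' => hfin T' (List.mem_cons_of_mem _ hT'))
      (fun T' hT' => hI T' (List.mem_cons_of_mem _ hT'))]
    have hTe : T.factor.mult e = Set.ncard {H : Set α | ¬ e.IsDiag ∧
        (∀ x ∈ e, x ∈ J ∧ x ∈ H) ∧ InducesP4 T.graph H} := by
      change Set.ncard _ = _
      congr 1
      ext H
      rw [Set.mem_ofPred_eq, Set.mem_ofPred_eq, hI T List.mem_cons_self]
      refine and_congr_right fun _ => ⟨?_, ?_⟩
      · rintro ⟨h1, h2⟩
        exact ⟨fun x hx => ⟨(h1 x hx).1.1, (h1 x hx).2⟩, h2⟩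
      · rintro ⟨h1, h2⟩
        exact ⟨fun x hx => ⟨⟨(h1 x hx).1, h2.1 (h1 x hx).2⟩, (h1 x hx).2⟩, h2⟩
    have hfin₁ : {H : Set α | ¬ e.IsDiag ∧ (∀ x ∈ e, x ∈ J ∧ x ∈ H) ∧
        InducesP4 T.graph H}.Finite :=
      (InducesP4.finite (hfin T List.mem_cons_self)).subset fun H hH => hH.2.2
    have hfin₂ : {H : Set α | ¬ e.IsDiag ∧ (∀ x ∈ e, x ∈ J ∧ x ∈ H) ∧
        ∃ T ∈ L, InducesP4 T.graph H}.Finite := by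
      refine (L.finite_toSet.biUnion fun T' hT' =>
        InducesP4.finite (hfin T' (List.mem_cons_of_mem _ hT'))).subset ?_
      rintro H ⟨-, -, T', hT', h⟩
      exact Set.mem_biUnion (x := T') hT' h
    rw [hTe, ← Set.ncard_union_eq ?_ hfin₁ hfin₂]
    · congr 1
      ext H
      simp only [Set.mem_union, Set.mem_ofPred_eq, List.mem_cons, exists_eq_or_imp]
      tauto
    · rw [Set.disjoint_left]
      rintro H ⟨-, -, h1⟩ ⟨-, -, T', hT', h2⟩
      obtain ⟨x, hx⟩ := h1.nonempty
      exact Set.disjoint_left.1 (hT T' hT') (h1.1 hx) (h2.1 hx)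

theorem factor_eq_listUnion {S : SplitGraph α} (hfin : S.graph.verts.Finite)
    {L : List (SplitGraph α)}
    (hL : L.Pairwise fun T T' => Disjoint T.graph.verts T'.graph.verts)
    (hact : ∀ T ∈ L, IsActive T.graph) (hS : S.graph = prod L) :
    S.factor = Multigraph.listUnion (L.map fun T => T.factor) := by
  have hI : ∀ T ∈ L, T.I = S.I ∩ T.graph.verts := fun T hT =>
    I_eq_inter_of_prod hL hS hT (hact T hT)
  have hverts : ∀ x, x ∈ S.graph.verts ↔ ∃ T ∈ L, x ∈ T.graph.verts := by
    intro x
    rw [hS, prod, mem_verts_compList]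
    simp
  apply Multigraph.ext
  · ext x
    simp only [Multigraph.listUnion, List.mem_map, exists_exists_and_eq_and, Set.mem_ofPred_eq]
    constructor
    · intro hx
      obtain ⟨T, hT, hxT⟩ := (hverts x).1 (S.I_subset_verts hx)
      refine ⟨T, hT, ?_⟩
      change x ∈ T.I
      rw [hI T hT]
      exact ⟨hx, hxT⟩
    · rintro ⟨T, hT, hx⟩
      have hx' : x ∈ T.I := hx
      rw [hI T hT] at hx'
      exact hx'.1
  · funext e
    have hf : ∀ T ∈ L, T.graph.verts.Finite := fun T hT =>
      hfin.subset fun x hx => (hverts x).2 ⟨T, hT, hx⟩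
    have := sum_mult_factor hL hf hI e
    simp only [Multigraph.listUnion, List.map_map, Function.comp_def]
    rw [this]
    change Set.ncard _ = _
    simp only [hS, inducesP4_prod_iff hL]

/-! ### Connectivity of the factor multigraph and irreducibility -/

/-- Two vertices of `I` are adjacent in the factor multigraph if and only if their neighbourhoods are
incomparable. -/
theorem factor_adj_iff {S : SplitGraph α} (hfin : S.graph.verts.Finite)
    (u v : S.factor.verts) :
    S.factor.toSimple.Adj u v ↔
      (∃ x, S.graph.Adj u x ∧ ¬ S.graph.Adj v x) ∧ ∃ x, S.graph.Adj v x ∧ ¬ S.graph.Adj u x := by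
  have hu : (u : α) ∈ S.I := u.2
  have hv : (v : α) ∈ S.I := v.2
  have hmult : S.factor.mult s((u : α), (v : α)) ≠ 0 ↔
      (u : α) ≠ v ∧ ∃ H : Set α, (u : α) ∈ H ∧ (v : α) ∈ H ∧ InducesP4 S.graph H := by
    change Set.ncard _ ≠ 0 ↔ _
    -- Finiteness matters here: an infinite set would have `ncard` equal to `0`.
    rw [← Nat.pos_iff_ne_zero,
      Set.ncard_pos ((InducesP4.finite hfin).subset fun H hH => hH.2.2)]
    simp [Set.Nonempty, hu, hv, and_assoc]
  have hadj : S.factor.toSimple.Adj u v ↔ S.factor.mult s((u : α), (v : α)) ≠ 0 := by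
    rw [Multigraph.toSimple, SimpleGraph.fromRel_adj, Sym2.eq_swap (a := (v : α)), or_self]
    refine and_iff_right_of_imp fun h => ?_
    exact fun huv => (hmult.1 h).1 (congrArg Subtype.val huv)
  rw [hadj, hmult]
  constructor
  · rintro ⟨hne, H, huH, hvH, hH⟩
    obtain ⟨a, b, c, d, hp, rfl⟩ := inducesP4_iff.1 hH
    obtain ⟨ha, hb, hc, hd⟩ := S.mem_of_path hp
    obtain ⟨hab, hbc, hcd, hac, had, hbd⟩ := hp
    have hend : ∀ x ∈ S.I, x ∈ ({a, b, c, d} : Set α) → x = a ∨ x = d := by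
      rintro x hx (h | rfl | rfl | h)
      exacts [Or.inl h, absurd hx (S.notMem_I_of_mem_K hb),
        absurd hx (S.notMem_I_of_mem_K hc), Or.inr h]
    have h1 : ¬ S.graph.Adj d b := fun h => hbd h.symm
    rcases hend _ hu huH with h | h <;> rcases hend _ hv hvH with h' | h'
    · exact absurd (h.trans h'.symm) hne
    · rw [h, h']
      exact ⟨⟨b, hab, h1⟩, c, hcd.symm, hac⟩
    · rw [h, h']
      exact ⟨⟨c, hcd.symm, hac⟩, b, hab, h1⟩
    · exact absurd (h.trans h'.symm) hne
  · rintro ⟨⟨x, hux, hvx⟩, y, hvy, huy⟩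
    refine ⟨fun h => hvx (h ▸ hux), {(u : α), x, y, (v : α)}, by simp, by simp, ?_⟩
    refine inducesP4_iff.2 ⟨u, x, y, v, ⟨hux, ?_, hvy.symm, huy, S.indep hu hv,
      fun h => hvx h.symm⟩, rfl⟩
    refine S.clique (S.mem_K_of_adj hux hu) (S.mem_K_of_adj hvy hv) ?_
    rintro rfl
    exact hvx hvy

theorem isIrreducible_of_factor_isConnected {S : SplitGraph α} (hfin : S.graph.verts.Finite)
    (hact : IsActive S.graph) (hconn : S.factor.IsConnected) : IsIrreducible S.graph := by
  rintro ⟨T, H, hT, hH, hd, hS⟩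
  obtain ⟨hTact, hHact⟩ := isActive_of_isActive_comp hd (hS ▸ hact)
  obtain ⟨u, huT, huI⟩ := S.exists_mem_I hT hTact fun x hx y hy =>
    (hS ▸ comp_adj_left hd hx hy).symm
  obtain ⟨v, hvH, hvI⟩ := S.exists_mem_I hH hHact fun x hx y hy =>
    (hS ▸ comp_adj_right hd hx hy).symm
  -- An edge of `Φ(S)` comes from an induced `P₄`, which lies within one side of `T ∘ H`.
  have key : ∀ x y : S.factor.verts, S.factor.toSimple.Adj x y → (x : α) ∈ T.graph.verts →
      (y : α) ∈ T.graph.verts := by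
    intro x y hxy hx
    obtain ⟨⟨p, hxp, hyp⟩, q, hyq, hxq⟩ := (factor_adj_iff hfin x y).1 hxy
    have hxI : (x : α) ∈ S.I := x.2
    have hyI : (y : α) ∈ S.I := y.2
    have hp : IsPath4 S.graph x p q y := by
      refine ⟨hxp, S.clique (S.mem_K_of_adj hxp hxI) (S.mem_K_of_adj hyq hyI) ?_, hyq.symm, hxq,
        S.indep hxI hyI, fun h => hyp h.symm⟩
      rintro rfl
      exact hyp hyq
    rw [hS] at hp
    rcases (path_comp_iff hd).1 hp with h | h
    · exact h.2.2.1.snd_mem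
    · exact absurd h.1.fst_mem (Set.disjoint_left.1 hd hx)
  obtain ⟨w⟩ := hconn ⟨u, huI⟩ ⟨v, hvI⟩
  have hwalk : ∀ (x y : S.factor.verts), S.factor.toSimple.Walk x y → (x : α) ∈ T.graph.verts →
      (y : α) ∈ T.graph.verts := by
    intro x y p
    induction p with
    | nil => exact id
    | cons h _ ih => exact fun hx => ih (key _ _ h hx)
  exact Set.disjoint_left.1 hd (hwalk _ _ w huT) hvH

/-- If the neighbourhood of every vertex of `J` is contained in that of every vertex of `I \ J`,
then `J` and its neighbours split off. -/
theorem isReducible_of_neighbors_le {S : SplitGraph α} {J : Set α} (hJI : J ⊆ S.I)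
    (hJ : J.Nonempty) (hJ' : (S.I \ J).Nonempty)
    (h : ∀ u ∈ J, ∀ v ∈ S.I \ J, ∀ x, S.graph.Adj u x → S.graph.Adj v x) :
    IsReducible S.graph := by
  set A : Set α := {x | ∃ u ∈ J, S.graph.Adj u x} with hA
  have hAK : A ⊆ S.K := by
    rintro x ⟨u, hu, hux⟩
    exact S.mem_K_of_adj hux (hJI hu)
  let T : SplitGraph α :=
    { graph := S.graph.induce (A ∪ J)
      K := A
      I := J
      disjoint := S.disjoint.mono hAK hJI
      union_eq := rfl
      clique := fun x hx y hy hxy => ⟨Or.inl hx, Or.inl hy, S.clique (hAK hx) (hAK hy) hxy⟩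
      indep := fun x hx y hy hxy => S.indep (hJI hx) (hJI hy) hxy.2.2 }
  refine ⟨T, S.graph.induce (S.graph.verts \ (A ∪ J)), hJ.mono Set.subset_union_right, ?_,
    Set.disjoint_sdiff_right, ?_⟩
  · obtain ⟨v, hv, hvJ⟩ := hJ'
    refine ⟨v, S.I_subset_verts hv, ?_⟩
    rintro (hvA | hvJ')
    · exact S.notMem_I_of_mem_K (hAK hvA) hv
    · exact hvJ hvJ'
  · have hsub : A ∪ J ⊆ S.graph.verts :=
      Set.union_subset (hAK.trans S.K_subset_verts) (hJI.trans S.I_subset_verts)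
    -- The hypothesis on neighbourhoods is what makes `A` complete to the remaining vertices of `I`.
    have hcross : ∀ x ∈ A, ∀ y ∈ S.graph.verts \ (A ∪ J), S.graph.Adj x y := by
      rintro x ⟨u, hu, hux⟩ y ⟨hy, hyn⟩
      rcases S.mem_K_or_mem_I hy with hyK | hyI
      · refine S.clique (hAK ⟨u, hu, hux⟩) hyK ?_
        rintro rfl
        exact hyn (Or.inl ⟨u, hu, hux⟩)
      · exact (h u hu y ⟨hyI, fun hyJ => hyn (Or.inr hyJ)⟩ x hux).symm
    apply SimpleGraph.Subgraph.ext
    · exact (Set.union_sdiff_cancel hsub).symm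
    · funext x y
      apply propext
      constructor
      · intro hxy
        by_cases hx : x ∈ A ∪ J <;> by_cases hy : y ∈ A ∪ J
        · exact Or.inl ⟨hx, hy, hxy⟩
        · refine Or.inr (Or.inr ⟨hxy.ne, Or.inl ⟨?_, hxy.snd_mem, hy⟩⟩)
          exact hx.resolve_right fun hxJ => hy (Or.inl ⟨x, hxJ, hxy⟩)
        · refine Or.inr (Or.inr ⟨hxy.ne, Or.inr ⟨?_, hxy.fst_mem, hx⟩⟩)
          exact hy.resolve_right fun hyJ => hx (Or.inl ⟨y, hyJ, hxy.symm⟩)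
        · exact Or.inr (Or.inl ⟨⟨hxy.fst_mem, hx⟩, ⟨hxy.snd_mem, hy⟩, hxy⟩)
      · rintro (hxy | hxy | ⟨-, ⟨hx, hy⟩ | ⟨hy, hx⟩⟩)
        exacts [hxy.2.2, hxy.2.2, hcross x hx y hy, (hcross y hy x hx).symm]

theorem factor_isConnected_of_isPrime {S : SplitGraph α} (hfin : S.graph.verts.Finite)
    (hS : IsPrime S.graph) : S.factor.IsConnected := by
  obtain ⟨hact, hirr⟩ := hS
  let Le : S.factor.verts → S.factor.verts → Prop := fun u v =>
    ∀ x, S.graph.Adj u x → S.graph.Adj v x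
  have hadj : ∀ u v, S.factor.toSimple.Adj u v ↔ ¬ Le u v ∧ ¬ Le v u := by
    intro u v
    rw [factor_adj_iff hfin]
    simp only [Le, not_forall, exists_prop]
  have htotal : ∀ u v, ¬ S.factor.toSimple.Reachable u v → Le u v ∨ Le v u := by
    intro u v huv
    by_contra hcon
    exact huv ((hadj u v).2 (not_or.1 hcon)).reachable
  have hnot : ∀ a b, ¬ S.factor.toSimple.Reachable a b → ¬ Le a b := by
    intro a b hab hle
    -- Comparability with `b` propagates along the component of `a`: for an edge `ad`, having `Le b
    -- d` would give `Le a d` through `b`, but adjacent vertices are incomparable.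
    have hup : ∀ c, S.factor.toSimple.Reachable a c → Le c b := by
      rintro c ⟨w⟩
      induction w with
      | nil => exact hle
      | @cons a d c h w ih =>
        have hdb : ¬ S.factor.toSimple.Reachable d b := fun hr => hab (h.reachable.trans hr)
        refine ih hdb ((htotal d b hdb).resolve_right fun hbd => ?_)
        exact ((hadj a d).1 h).1 fun x hx => hbd x (hle x hx)
    -- The down-closure of the component of `a`; the component alone need not lie below every other
    -- vertex.
    let J : Set α := {u | ∃ (hu : u ∈ S.I) (c : S.factor.verts),
      S.factor.toSimple.Reachable a c ∧ Le ⟨u, hu⟩ c}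
    refine hirr (isReducible_of_neighbors_le (J := J) (fun u hu => hu.1) ?_ ?_ ?_)
    · exact ⟨a, a.2, a, SimpleGraph.Reachable.refl a, fun x hx => hx⟩
    · refine ⟨b, b.2, ?_⟩
      rintro ⟨_, c, hac, (hbc : Le b c)⟩
      -- If `b` were in `J`, then `b` and `c` would have equal neighbourhoods. Activity of `c` gives
      -- it a neighbour `d` in `Φ(S)`, which is then also a neighbour of `b`, joining `b` to `a`.
      have hcb := hup c hac
      obtain ⟨p, q, d, hp⟩ := S.exists_path_of_mem_I c.2 (hact c (S.I_subset_verts c.2))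
      have hd : d ∈ S.I := (S.mem_of_path hp).2.2.2
      obtain ⟨hcp, hpq, hqd, hcq, hcd, hpd⟩ := hp
      have h1 : S.factor.toSimple.Adj c ⟨d, hd⟩ :=
        (factor_adj_iff hfin _ _).2 ⟨⟨p, hcp, fun h => hpd h.symm⟩, q, hqd.symm, hcq⟩
      have h2 : S.factor.toSimple.Adj ⟨d, hd⟩ b :=
        (factor_adj_iff hfin _ _).2
          ⟨⟨q, hqd.symm, fun h => hcq (hbc q h)⟩, p, hcb p hcp, fun h => hpd h.symm⟩
      exact hab (hac.trans (h1.reachable.trans h2.reachable))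
    · rintro u ⟨hu, c, hac, huc⟩ v ⟨hv, hvJ⟩ x hux
      have hvc : ¬ Le ⟨v, hv⟩ c := fun hle => hvJ ⟨hv, c, hac, hle⟩
      have hcv : ¬ S.factor.toSimple.Reachable c ⟨v, hv⟩ := fun hr =>
        hvJ ⟨hv, ⟨v, hv⟩, hac.trans hr, fun x hx => hx⟩
      exact (htotal c ⟨v, hv⟩ hcv).resolve_right hvc x (huc x hux)
  intro a b
  by_contra hab
  rcases htotal a b hab with h | h
  · exact hnot a b hab h
  · exact hnot b a (fun hr => hab hr.symm) h

end SplitGraph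

end TyshkevichGraph

theorem mainTheorem4 {α : Type*} (S : TyshkevichGraph.SplitGraph α)
    (hfin : S.graph.verts.Finite) (hact : TyshkevichGraph.IsActive S.graph) :
    -- if the factor multigraph is connected, then `S` is irreducible
    (S.factor.IsConnected → TyshkevichGraph.IsIrreducible S.graph) ∧
    -- `S` is prime iff its factor multigraph is connected
    (TyshkevichGraph.IsPrime S.graph ↔ S.factor.IsConnected) ∧
    -- if `S` is a product of primes, its factor multigraph is the disjoint union of theirs
    (∀ L : List (TyshkevichGraph.SplitGraph α),
      L.Pairwise (fun T T' => Disjoint T.graph.verts T'.graph.verts) →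
      (∀ T ∈ L, TyshkevichGraph.IsPrime T.graph) →
      S.graph = TyshkevichGraph.prod L →
      (L.map fun T => T.factor).Pairwise (fun M M' => Disjoint M.verts M'.verts) ∧
      S.factor = TyshkevichGraph.Multigraph.listUnion (L.map fun T => T.factor)) ∧
    -- every factor in a decomposition of an active graph into irreducibles is prime
    (∀ (G : TyshkevichGraph.LGraph α) (L : List (TyshkevichGraph.SplitGraph α))
      (G₁ : TyshkevichGraph.LGraph α),
      TyshkevichGraph.IsActive G →
      L.Pairwise (fun T T' => Disjoint T.graph.verts T'.graph.verts) →
      (∀ T ∈ L, Disjoint T.graph.verts G₁.verts) →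
      (∀ T ∈ L, TyshkevichGraph.IsIrreducible T.graph) →
      TyshkevichGraph.IsIrreducible G₁ →
      G = TyshkevichGraph.compList L G₁ →
      (∀ T ∈ L, TyshkevichGraph.IsPrime T.graph) ∧ TyshkevichGraph.IsPrime G₁) := by
  open TyshkevichGraph in
  refine ⟨SplitGraph.isIrreducible_of_factor_isConnected hfin hact,
    ⟨SplitGraph.factor_isConnected_of_isPrime hfin, fun h =>
      ⟨hact, SplitGraph.isIrreducible_of_factor_isConnected hfin hact h⟩⟩, ?_, ?_⟩
  · intro L hL hprime hS
    refine ⟨?_, SplitGraph.factor_eq_listUnion hfin hL (fun T hT => (hprime T hT).1) hS⟩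
    rw [List.pairwise_map]
    exact hL.imp fun {T T'} h => h.mono T.I_subset_verts T'.I_subset_verts
  · rintro G L G₁ hG hL hLG hirr hirr₁ rfl
    obtain ⟨h1, h2⟩ := isActive_of_isActive_compList hL hLG hG
    exact ⟨fun T hT => ⟨h1 T hT, hirr T hT⟩, h2, hirr₁⟩
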